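/- For a real symmetric $n\times n$ matrix $A$ with $n\ge 2$, let $\delta_1(A)\ge\delta_2(A)\ge\dots\ge\delta_n(A)$ be its eigenvalues, counted with multiplicity, and put $\lambda_2(A)=\max(|\delta_2(A)|,|\delta_n(A)|)$. For every constant $p>0$ there exist constants $c_p,K_p>0$, depending only on $p$, such that the following holds. Let $n\ge 2$, let $a_{ij}$ ($1\le i\le j\le n$) be independent real random variables (not necessarily identically distributed) with absolute value at most $1$, and suppose that $\mathbb{E}[a_{ij}]=p$ for all $1\le i<j\le n$. Let $A$ be the random symmetric $n\times n$ matrix with entries $a_{ij}$ for $i\le j$ and $a_{ji}=a_{ij}$ for $i<j$. Then, for all $t>K_p$, $$\Pr\bigl[\,|\lambda_2(A)-\mathbb{E}\lambda_2(A)|\ge t\,\bigr]\le e^{-c_pt^2} \qquad\text{and}\qquad \Pr\bigl[\,|\delta_2(A)-\mathbb{E}\delta_2(A)|\ge t\,\bigr]\le e^{-c_pt^2}.$$ -/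

import Mathlib

open MeasureTheory ProbabilityTheory

/-- The symmetric matrix with entries `a i j` for `i ≤ j`, completed by `a_{ji} = a_{ij}`.
The values of `a` below the diagonal are not used. -/
def symMatrix {n : ℕ} (a : Fin n → Fin n → ℝ) : Matrix (Fin n) (Fin n) ℝ :=
  Matrix.of fun i j => a (min i j) (max i j)

theorem symMatrix_isHermitian {n : ℕ} (a : Fin n → Fin n → ℝ) :
    (symMatrix a).IsHermitian := by
  ext i j
  simp [symMatrix, min_comm, max_comm]

/-- The eigenvalues of a real symmetric matrix, with multiplicity and in non-increasing order:
`delta hA i` is the `(i + 1)`-st largest one (the index `i` starts from `0`). -/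
noncomputable def delta {n : ℕ} {A : Matrix (Fin n) (Fin n) ℝ} (hA : A.IsHermitian)
    (i : Fin n) : ℝ :=
  hA.eigenvalues₀ (Fin.cast (Fintype.card_fin n).symm i)

/-- The second largest eigenvalue `δ₂(A)`. -/
noncomputable def delta2 {n : ℕ} (hn : 2 ≤ n) {A : Matrix (Fin n) (Fin n) ℝ}
    (hA : A.IsHermitian) : ℝ :=
  delta hA ⟨1, by omega⟩

/-- The smallest eigenvalue `δₙ(A)`. -/
noncomputable def deltaLast {n : ℕ} (hn : 2 ≤ n) {A : Matrix (Fin n) (Fin n) ℝ}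
    (hA : A.IsHermitian) : ℝ :=
  delta hA ⟨n - 1, by omega⟩

/-- `λ₂(A) = max (|δ₂(A)|, |δₙ(A)|)`. -/
noncomputable def lambda2 {n : ℕ} (hn : 2 ≤ n) {A : Matrix (Fin n) (Fin n) ℝ}
    (hA : A.IsHermitian) : ℝ :=
  max |delta2 hn hA| |deltaLast hn hA|

/-- `λ₂` of the random symmetric matrix with upper triangular entries `a i j`, `i ≤ j`. -/
noncomputable def randLambda2 {Ω : Type*} {n : ℕ} (hn : 2 ≤ n) (a : Fin n → Fin n → Ω → ℝ)
    (ω : Ω) : ℝ :=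
  lambda2 hn (symMatrix_isHermitian fun i j => a i j ω)

/-- `δ₂` of the random symmetric matrix with upper triangular entries `a i j`, `i ≤ j`. -/
noncomputable def randDelta2 {Ω : Type*} {n : ℕ} (hn : 2 ≤ n) (a : Fin n → Fin n → Ω → ℝ)
    (ω : Ω) : ℝ :=
  delta2 hn (symMatrix_isHermitian fun i j => a i j ω)

/-! Both functionals obey a one-sided Lipschitz bound. At each matrix B, F(B) - F(A) ≤ ∑ β_e |b_e -
a_e| for all A, with weights β that depend on B alone and have ℓ² norm at most 4, whatever n is.
Talagrand's convex distance inequality turns such a bound into Gaussian concentration with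
dimension-free constants.

For δ₂ the weights come from Courant–Fischer (`exists_envelope_delta2`). The plane of the two
leading eigenvectors of B contains a unit vector w orthogonal to the leading eigenvector of A, so
wᵀAw ≤ δ₂(A) and wᵀBw ≥ δ₂(B). Although w depends on A, its i-th coordinate is at most the length
r_i of the projection of the i-th standard vector to that plane, so β_ij = 2 r_i r_j works. For -δₙ
the last eigenvector of B suffices. Finally λ₂ = max(δ₂, -δₙ), and the Lipschitz condition survives
maxima.

Talagrand's inequality (`exists_inDisagreementHull_sum_exp_le`) is proved for finite alphabets by
induction on the number of coordinates. The hull is described by its nonnegative linear functionals,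
which is all the application uses, so no minimax argument is needed. A grid approximation passes to
variables in [-1, 1]. The resulting two-set bound gives concentration around a median, and
integrating the tail moves it to the mean. -/

/-! ### Talagrand's convex distance inequality on finite product spaces -/

/-- The mass that the product of the weights `w i` gives to the set `S`. -/
def prodMass {α : Type*} {m : ℕ} (w : Fin m → α → ℝ) (S : Finset (Fin m → α)) : ℝ :=
  ∑ x ∈ S, ∏ i, w i (x i)

/-- The vector `z` is dominated from below by the convex hull of the disagreement vectors
`(1_{x i ≠ a i})_i`, `a ∈ S`, as far as nonnegative linear functionals can see. -/
def InDisagreementHull {α : Type*} [DecidableEq α] {m : ℕ} (S : Finset (Fin m → α))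
    (x : Fin m → α) (z : Fin m → ℝ) : Prop :=
  ∀ (β : Fin m → ℝ) (t : ℝ), (∀ i, 0 ≤ β i) →
    (∀ a ∈ S, t ≤ ∑ i, if x i ≠ a i then β i else 0) → t ≤ ∑ i, β i * z i

/-- The optimisation that closes the induction, with r the mass of a section over the mass of the
projection. For r = e^(-u) the exponent ul + (1-l)²/4 is least at l = 1 - 2u, with value u - u². If
u > 1/2, the endpoint l = 0 is enough, as e^(1/4) ≤ 2 - e^(-1/2). -/
theorem exists_rpow_neg_mul_exp_le {r : ℝ} (hr0 : 0 < r) (hr1 : r ≤ 1) :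
    ∃ l : ℝ, 0 ≤ l ∧ l ≤ 1 ∧ (1 / r) ^ l * Real.exp ((1 - l) ^ 2 / 4) ≤ 2 - r := by
  obtain ⟨u, rfl⟩ : ∃ u, r = Real.exp (-u) := ⟨-Real.log r, by simp [Real.exp_log hr0]⟩
  have hu : 0 ≤ u := by simpa using hr1
  have hinv : 1 / Real.exp (-u) = Real.exp u := by rw [Real.exp_neg]; simp
  have hneg : ∀ s : ℝ, 0 ≤ s → Real.exp (-s) ≤ 1 - s + s ^ 2 / 2 := by
    intro s hs
    have h1 := Real.quadratic_le_exp_of_nonneg hs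
    have h2 : Real.exp (-s) * Real.exp s = 1 := by rw [← Real.exp_add]; simp
    have h3 : (0 : ℝ) < Real.exp (-s) := Real.exp_pos _
    have h4 : 0 ≤ 1 - s + s ^ 2 / 2 := by nlinarith [sq_nonneg (s - 1)]
    -- (1 + s + s²/2)(1 - s + s²/2) = 1 + s⁴/4 ≥ 1.
    nlinarith [mul_le_mul_of_nonneg_left h1 h4, sq_nonneg (s ^ 2), Real.exp_pos s,
      mul_le_mul_of_nonneg_left h1 h3.le]
  have hcube : ∀ s : ℝ, 0 ≤ s → s ≤ 1 → Real.exp s ≤ 1 + s + s ^ 2 / 2 + s ^ 3 / 4 := by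
    intro s hs hs1
    have h := Real.exp_bound' hs hs1 (n := 3) (by norm_num)
    simp only [Finset.sum_range_succ, Finset.sum_range_zero, Nat.factorial] at h
    norm_num at h
    nlinarith [pow_nonneg hs 3]
  by_cases h : u ≤ 1 / 2
  · refine ⟨1 - 2 * u, by linarith, by linarith, ?_⟩
    rw [hinv, ← Real.exp_mul, ← Real.exp_add]
    have e : u * (1 - 2 * u) + (1 - (1 - 2 * u)) ^ 2 / 4 = u - u ^ 2 := by ring
    rw [e]
    have hv0 : 0 ≤ u - u ^ 2 := by nlinarith
    have h1 := hcube (u - u ^ 2) hv0 (by nlinarith)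
    have h2 := hneg u hu
    have h3 : (u - u ^ 2) ^ 3 ≤ u ^ 3 := pow_le_pow_left₀ hv0 (by nlinarith) 3
    have h4 : u ^ 4 ≤ u ^ 3 / 2 := by nlinarith [pow_nonneg hu 3]
    nlinarith [pow_nonneg hu 3]
  · refine ⟨0, le_rfl, zero_le_one, ?_⟩
    have h1 := hcube (1 / 4) (by norm_num) (by norm_num)
    have h2 := hneg (1 / 2) (by norm_num)
    have h3 : Real.exp (-u) ≤ Real.exp (-(1 / 2)) := Real.exp_le_exp.2 (by linarith)
    norm_num at h1 h2 ⊢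
    linarith [h3, h2, h1]

section
variable {α : Type*} {m : ℕ}

theorem prodMass_nonneg {w : Fin m → α → ℝ} (hw : ∀ i x, 0 ≤ w i x)
    (S : Finset (Fin m → α)) : 0 ≤ prodMass w S :=
  Finset.sum_nonneg fun _ _ => Finset.prod_nonneg fun i _ => hw i _

theorem prodMass_mono {w : Fin m → α → ℝ} (hw : ∀ i x, 0 ≤ w i x)
    {S T : Finset (Fin m → α)} (h : S ⊆ T) : prodMass w S ≤ prodMass w T :=
  Finset.sum_le_sum_of_subset_of_nonneg h fun _ _ _ => Finset.prod_nonneg fun i _ => hw i _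

theorem InDisagreementHull.convex [DecidableEq α] {S : Finset (Fin m → α)} {x : Fin m → α}
    {z z' : Fin m → ℝ} (h : InDisagreementHull S x z) (h' : InDisagreementHull S x z')
    {l : ℝ} (hl0 : 0 ≤ l) (hl1 : l ≤ 1) :
    InDisagreementHull S x fun i => l * z i + (1 - l) * z' i := by
  intro β t hβ ht
  have h1 := h β t hβ ht
  have h2 := h' β t hβ ht
  have : ∑ i, β i * (l * z i + (1 - l) * z' i) =
      l * ∑ i, β i * z i + (1 - l) * ∑ i, β i * z' i := by
    rw [Finset.mul_sum, Finset.mul_sum, ← Finset.sum_add_distrib]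
    exact Finset.sum_congr rfl fun i _ => by ring
  rw [this]
  nlinarith [mul_le_mul_of_nonneg_left h1 hl0, mul_le_mul_of_nonneg_left h2 (sub_nonneg.2 hl1)]

theorem sum_pi_succ [Fintype α] (g : (Fin (m + 1) → α) → ℝ) :
    ∑ x, g x = ∑ a, ∑ y : Fin m → α, g (Fin.cons a y) := by
  rw [← (Fin.consEquiv fun _ : Fin (m + 1) => α).sum_comp, Fintype.sum_prod_type]
  rfl

variable [Fintype α] [DecidableEq α]

theorem prodMass_succ (w : Fin (m + 1) → α → ℝ) (S : Finset (Fin (m + 1) → α)) :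
    prodMass w S = ∑ a, w 0 a *
      prodMass (fun i => w i.succ) (Finset.univ.filter fun y => Fin.cons a y ∈ S) := by
  have h : prodMass w S = ∑ x, if x ∈ S then ∏ i, w i (x i) else 0 := by
    rw [prodMass, ← Finset.sum_filter]; simp
  rw [h, sum_pi_succ]
  refine Finset.sum_congr rfl fun a _ => ?_
  rw [prodMass, Finset.sum_filter, Finset.mul_sum]
  refine Finset.sum_congr rfl fun y _ => ?_
  rw [Fin.prod_univ_succ]
  simp

/-- Points of `S` over the section agree with `Fin.cons a y` in the new coordinate, which therefore
costs 0. -/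
theorem InDisagreementHull.cons_section {S : Finset (Fin (m + 1) → α)} {a : α} {y : Fin m → α}
    {z : Fin m → ℝ}
    (h : InDisagreementHull (Finset.univ.filter fun y => Fin.cons a y ∈ S) y z) :
    InDisagreementHull S (Fin.cons a y) (Fin.cons 0 z) := by
  intro β t hβ ht
  rw [Fin.sum_univ_succ]
  have := h (fun i => β i.succ) t (fun i => hβ _) fun b hb => by
    have := ht _ (Finset.mem_filter.1 hb).2
    rw [Fin.sum_univ_succ] at this
    simpa using this
  simpa using this

/-- A lift to `S` of a point of the projection may disagree in the new coordinate, at a cost of at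
most 1. -/
theorem InDisagreementHull.cons_proj {S : Finset (Fin (m + 1) → α)} {a : α} {y : Fin m → α}
    {z : Fin m → ℝ}
    (h : InDisagreementHull (Finset.univ.filter fun y => ∃ a, Fin.cons a y ∈ S) y z) :
    InDisagreementHull S (Fin.cons a y) (Fin.cons 1 z) := by
  intro β t hβ ht
  rw [Fin.sum_univ_succ]
  have := h (fun i => β i.succ) (t - β 0) (fun i => hβ _) fun b hb => by
    obtain ⟨c, hc⟩ := (Finset.mem_filter.1 hb).2
    have := ht _ hc
    rw [Fin.sum_univ_succ] at this
    simp only [Fin.cons_zero, Fin.cons_succ] at this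
    have h0 : (if a ≠ c then β 0 else 0) ≤ β 0 := by
      split_ifs
      exacts [le_rfl, hβ 0]
    linarith
  simp only [Fin.cons_zero, Fin.cons_succ]
  linarith

/-- Hölder's inequality for a finite sum, with upper bounds for the two factors. -/
theorem sum_exp_convex_comb_le {ι : Type*} [Fintype ι] {w f g : ι → ℝ} (hw : ∀ i, 0 ≤ w i)
    {U V l : ℝ} (hU : 0 < U) (hV : 0 < V) (hl0 : 0 ≤ l) (hl1 : l ≤ 1)
    (hf : ∑ i, w i * Real.exp (f i) ≤ U) (hg : ∑ i, w i * Real.exp (g i) ≤ V) :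
    ∑ i, w i * Real.exp (l * f i + (1 - l) * g i) ≤ U ^ l * V ^ (1 - l) := by
  -- Weighted AM-GM for each term, after dividing the two factors by their bounds.
  have key : ∀ i, w i * Real.exp (l * f i + (1 - l) * g i) ≤
      (U ^ l * V ^ (1 - l)) *
        (l * (w i * Real.exp (f i)) / U + (1 - l) * (w i * Real.exp (g i)) / V) := by
    intro i
    have h := Real.geom_mean_le_arith_mean2_weighted hl0 (sub_nonneg.2 hl1)
      (div_pos (Real.exp_pos (f i)) hU).le (div_pos (Real.exp_pos (g i)) hV).le (by ring)
    rw [Real.div_rpow (Real.exp_pos _).le hU.le, Real.div_rpow (Real.exp_pos _).le hV.le,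
      ← Real.exp_mul, ← Real.exp_mul, div_mul_div_comm, ← Real.exp_add,
      div_le_iff₀ (by positivity)] at h
    have h2 := mul_le_mul_of_nonneg_left h (hw i)
    calc _ = w i * Real.exp (f i * l + g i * (1 - l)) := by congr 2; ring
      _ ≤ _ := h2
      _ = _ := by ring
  refine (Finset.sum_le_sum fun i _ => key i).trans ?_
  rw [← Finset.mul_sum, Finset.sum_add_distrib, ← Finset.sum_div, ← Finset.sum_div,
    ← Finset.mul_sum, ← Finset.mul_sum]
  have h1 : l * (∑ i, w i * Real.exp (f i)) / U ≤ l := by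
    rw [div_le_iff₀ hU]; exact mul_le_mul_of_nonneg_left hf hl0
  have h2 : (1 - l) * (∑ i, w i * Real.exp (g i)) / V ≤ 1 - l := by
    rw [div_le_iff₀ hV]; exact mul_le_mul_of_nonneg_left hg (sub_nonneg.2 hl1)
  have h3 : 0 ≤ U ^ l * V ^ (1 - l) := by positivity
  nlinarith

theorem sum_sq_convex_comb_le {z z' : Fin m → ℝ} {l : ℝ} (hl0 : 0 ≤ l) (hl1 : l ≤ 1) :
    ∑ i, (l * z i + (1 - l) * z' i) ^ 2 ≤ l * ∑ i, z i ^ 2 + (1 - l) * ∑ i, z' i ^ 2 := by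
  rw [Finset.mul_sum, Finset.mul_sum, ← Finset.sum_add_distrib]
  refine Finset.sum_le_sum fun i _ => ?_
  nlinarith [mul_nonneg (mul_nonneg hl0 (sub_nonneg.2 hl1)) (sq_nonneg (z i - z' i))]

/-- **Talagrand's inequality** for the convex distance on a finite product space, with the
convex distance replaced by the length of a suitable vector of the disagreement hull. -/
theorem exists_inDisagreementHull_sum_exp_le (w : Fin m → α → ℝ) (hw : ∀ i x, 0 ≤ w i x)
    (hw1 : ∀ i, ∑ x, w i x = 1) (S : Finset (Fin m → α)) (hS : 0 < prodMass w S) :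
    ∃ z : (Fin m → α) → Fin m → ℝ, (∀ x, InDisagreementHull S x (z x)) ∧
      ∑ x, (∏ i, w i (x i)) * Real.exp (∑ i, z x i ^ 2 / 4) ≤ 1 / prodMass w S := by
  induction m with
  | zero =>
    have hne : S.Nonempty := by
      by_contra h
      rw [Finset.not_nonempty_iff_eq_empty] at h
      simp [h, prodMass] at hS
    obtain ⟨a, ha⟩ := hne
    refine ⟨fun _ => 0, fun x β t _ ht => by simpa using ht a ha, ?_⟩
    have : S = {a} := by
      ext b; simp [Subsingleton.elim b a, ha]
    simp [this, prodMass]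
  | succ m ih =>
    set w' : Fin m → α → ℝ := fun i => w i.succ with hw'
    set B : Finset (Fin m → α) := Finset.univ.filter fun y => ∃ a, Fin.cons a y ∈ S with hB
    set T : α → Finset (Fin m → α) := fun a => Finset.univ.filter fun y => Fin.cons a y ∈ S
      with hT
    have hw'0 : ∀ i x, 0 ≤ w' i x := fun i x => hw _ _
    have hTB : ∀ a, prodMass w' (T a) ≤ prodMass w' B := fun a =>
      prodMass_mono hw'0 fun y hy => by
        simp only [hT, hB, Finset.mem_filter] at hy ⊢
        exact ⟨hy.1, a, hy.2⟩
    have hSsum : prodMass w S = ∑ a, w 0 a * prodMass w' (T a) := prodMass_succ w S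
    have hBpos : 0 < prodMass w' B := by
      by_contra hneg
      have : prodMass w S ≤ 0 := by
        rw [hSsum]
        exact Finset.sum_nonpos fun a _ =>
          mul_nonpos_of_nonneg_of_nonpos (hw _ _) ((hTB a).trans (not_lt.1 hneg))
      linarith
    set b := prodMass w' B with hb
    obtain ⟨zB, hzB, hsB⟩ := ih w' hw'0 (fun i => hw1 _) B hBpos
    have key : ∀ a, ∃ z : (Fin m → α) → Fin (m + 1) → ℝ,
        (∀ y, InDisagreementHull S (Fin.cons a y) (z y)) ∧
        ∑ y, (∏ i, w' i (y i)) * Real.exp (∑ i, z y i ^ 2 / 4) ≤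
          (2 - prodMass w' (T a) / b) / b := by
      intro a
      -- A section of mass zero has no inductive vector. The projection alone then serves (l = 0),
      -- at cost e^(1/4) ≤ 2.
      by_cases h0 : prodMass w' (T a) = 0
      · refine ⟨fun y => Fin.cons 1 (zB y), fun y => (hzB y).cons_proj, ?_⟩
        simp only [Fin.sum_univ_succ, Fin.cons_zero, Fin.cons_succ, Real.exp_add]
        have he : Real.exp (1 ^ 2 / 4) ≤ 2 := by
          have h := Real.exp_bound' (x := 1 / 4) (by norm_num) (by norm_num) (n := 1) one_pos
          norm_num at h ⊢
          linarith
        rw [h0]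
        calc _ = Real.exp (1 ^ 2 / 4) *
              ∑ y, (∏ i, w' i (y i)) * Real.exp (∑ i, zB y i ^ 2 / 4) := by
              rw [Finset.mul_sum]; exact Finset.sum_congr rfl fun y _ => by ring
          _ ≤ 2 * (1 / b) := mul_le_mul he hsB (Finset.sum_nonneg fun y _ =>
              mul_nonneg (Finset.prod_nonneg fun i _ => hw'0 _ _) (Real.exp_pos _).le)
              (by norm_num)
          _ = _ := by ring
      · have hTpos : 0 < prodMass w' (T a) := lt_of_le_of_ne (prodMass_nonneg hw'0 _) (Ne.symm h0)
        set q := prodMass w' (T a) with hq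
        obtain ⟨zT, hzT, hsT⟩ := ih w' hw'0 (fun i => hw1 _) (T a) hTpos
        obtain ⟨l, hl0, hl1, hl⟩ := exists_rpow_neg_mul_exp_le (div_pos hTpos hBpos)
          ((div_le_one hBpos).2 (hTB a))
        -- The new coordinate of this mixture is 1 - l, the source of the factor e^((1-l)²/4).
        -- Convexity of the square and Hölder handle the other coordinates.
        refine ⟨fun y i => l * (Fin.cons 0 (zT y) : Fin (m + 1) → ℝ) i +
          (1 - l) * (Fin.cons 1 (zB y) : Fin (m + 1) → ℝ) i,
          fun y => ((hzT y).cons_section).convex (hzB y).cons_proj hl0 hl1, ?_⟩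
        have hexp : ∀ y, Real.exp (∑ i, (l * (Fin.cons 0 (zT y) : Fin (m + 1) → ℝ) i +
            (1 - l) * (Fin.cons 1 (zB y) : Fin (m + 1) → ℝ) i) ^ 2 / 4) ≤
            Real.exp ((1 - l) ^ 2 / 4) * Real.exp (l * (∑ i, zT y i ^ 2 / 4) +
              (1 - l) * ∑ i, zB y i ^ 2 / 4) := by
          intro y
          rw [← Real.exp_add]
          apply Real.exp_le_exp.2
          have := sum_sq_convex_comb_le (z := zT y) (z' := zB y) hl0 hl1
          rw [Fin.sum_univ_succ]
          simp only [Fin.cons_zero, Fin.cons_succ, ← Finset.sum_div]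
          linarith
        have hH := sum_exp_convex_comb_le (w := fun y : Fin m → α => ∏ i, w' i (y i))
          (fun y => Finset.prod_nonneg fun i _ => hw'0 _ _) (one_div_pos.2 hTpos)
          (one_div_pos.2 hBpos) hl0 hl1 hsT hsB
        calc _ ≤ ∑ y, Real.exp ((1 - l) ^ 2 / 4) * ((∏ i, w' i (y i)) *
              Real.exp (l * (∑ i, zT y i ^ 2 / 4) + (1 - l) * ∑ i, zB y i ^ 2 / 4)) :=
              Finset.sum_le_sum fun y _ => by
                have := mul_le_mul_of_nonneg_left (hexp y)
                  (Finset.prod_nonneg fun i _ => hw'0 i (y i) : 0 ≤ ∏ i, w' i (y i))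
                linarith
          _ = Real.exp ((1 - l) ^ 2 / 4) * _ := by rw [← Finset.mul_sum]
          _ ≤ Real.exp ((1 - l) ^ 2 / 4) * ((1 / q) ^ l * (1 / b) ^ (1 - l)) :=
              mul_le_mul_of_nonneg_left hH (Real.exp_pos _).le
          _ = ((1 / (q / b)) ^ l * Real.exp ((1 - l) ^ 2 / 4)) / b := by
              have e : 1 / (q / b) = (1 / q) / (1 / b) := by field_simp
              rw [e, Real.div_rpow (one_div_pos.2 hTpos).le (one_div_pos.2 hBpos).le,
                Real.rpow_sub (by positivity), Real.rpow_one]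
              have : (1 / b) ^ l ≠ 0 := (Real.rpow_pos_of_pos (by positivity) _).ne'
              generalize (1 / b) ^ l = R at this ⊢
              generalize (1 / q) ^ l = P
              field_simp
          _ ≤ _ := div_le_div_of_nonneg_right hl hBpos.le
    choose z hz hzs using key
    refine ⟨fun x => z (x 0) (Fin.tail x), fun x => ?_, ?_⟩
    · have := hz (x 0) (Fin.tail x)
      rwa [Fin.cons_self_tail] at this
    · rw [sum_pi_succ]
      simp only [Fin.prod_univ_succ (n := m), Fin.cons_zero, Fin.cons_succ, Fin.tail_cons]
      calc _ = ∑ a, w 0 a * ∑ y, (∏ i, w' i (y i)) * Real.exp (∑ i, z a y i ^ 2 / 4) := by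
            refine Finset.sum_congr rfl fun a _ => ?_
            rw [Finset.mul_sum]
            exact Finset.sum_congr rfl fun y _ => by simp only [hw']; ring
        _ ≤ ∑ a, w 0 a * ((2 - prodMass w' (T a) / b) / b) :=
            Finset.sum_le_sum fun a _ => mul_le_mul_of_nonneg_left (hzs a) (hw _ _)
        _ = (2 - prodMass w S / b) / b := by
            rw [hSsum, Finset.sum_div, eq_div_iff hBpos.ne', Finset.sum_mul]
            have : (2 : ℝ) = ∑ a, w 0 a * 2 := by rw [← Finset.sum_mul, hw1]; simp
            rw [this, ← Finset.sum_sub_distrib]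
            refine Finset.sum_congr rfl fun a _ => ?_
            rw [← this]
            field_simp
        _ ≤ _ := by
            -- This is x(2 - x) ≤ 1 for x = `prodMass w S / b`.
            rw [div_le_div_iff₀ hBpos hS]
            have : prodMass w S = (prodMass w S / b) * b := by field_simp
            nlinarith [mul_nonneg hBpos.le (sq_nonneg (1 - prodMass w S / b))]

/-- By Cauchy–Schwarz, t ≤ β·z forces |z|² ≥ t²/D² on `T`. Markov's inequality for the exponential
moment of |z|²/4 then bounds the mass of `T`. -/
theorem prodMass_mul_prodMass_le (w : Fin m → α → ℝ) (hw : ∀ i x, 0 ≤ w i x)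
    (hw1 : ∀ i, ∑ x, w i x = 1) (S T : Finset (Fin m → α)) {t D : ℝ} (ht : 0 ≤ t) (hD : 0 < D)
    (h : ∀ x ∈ T, ∃ β : Fin m → ℝ, (∀ i, 0 ≤ β i) ∧ ∑ i, β i ^ 2 ≤ D ^ 2 ∧
      ∀ a ∈ S, t ≤ ∑ i, if x i ≠ a i then β i else 0) :
    prodMass w S * prodMass w T ≤ Real.exp (-(t ^ 2 / (4 * D ^ 2))) := by
  rcases (prodMass_nonneg hw S).eq_or_lt with h0 | hS
  · rw [← h0, zero_mul]; exact (Real.exp_pos _).le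
  obtain ⟨z, hz, hs⟩ := exists_inDisagreementHull_sum_exp_le w hw hw1 S hS
  have hlow : ∀ x ∈ T, Real.exp (t ^ 2 / (4 * D ^ 2)) ≤ Real.exp (∑ i, z x i ^ 2 / 4) := by
    intro x hx
    obtain ⟨β, hβ0, hβ, hβt⟩ := h x hx
    have h1 := hz x β t hβ0 hβt
    have h2 := Finset.sum_mul_sq_le_sq_mul_sq Finset.univ β (z x)
    have h3 : t ^ 2 ≤ D ^ 2 * ∑ i, z x i ^ 2 :=
      (pow_le_pow_left₀ ht h1 2).trans (h2.trans
        (mul_le_mul_of_nonneg_right hβ (Finset.sum_nonneg fun i _ => sq_nonneg _)))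
    apply Real.exp_le_exp.2
    rw [← Finset.sum_div, div_le_div_iff₀ (by positivity) (by norm_num)]
    nlinarith
  have h1 : prodMass w T * Real.exp (t ^ 2 / (4 * D ^ 2)) ≤ 1 / prodMass w S := by
    refine le_trans ?_ hs
    rw [prodMass, Finset.sum_mul]
    refine (Finset.sum_le_sum fun x hx => mul_le_mul_of_nonneg_left (hlow x hx)
      (Finset.prod_nonneg fun i _ => hw _ _)).trans ?_
    exact Finset.sum_le_sum_of_subset_of_nonneg (Finset.subset_univ _) fun x _ _ =>
      mul_nonneg (Finset.prod_nonneg fun i _ => hw _ _) (Real.exp_pos _).le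
  rw [le_div_iff₀ hS] at h1
  rw [Real.exp_neg, ← one_div, le_div_iff₀ (Real.exp_pos _)]
  linarith

end

/-! ### Lipschitz functions with point-dependent weights -/

/-- `F` is Lipschitz from above at each point `b`, for a weighted `ℓ¹` distance whose weights
may depend on `b` and have `ℓ²` norm at most `D`. -/
def WeightedLipschitz {E : Type*} [Fintype E] (D : ℝ) (F : (E → ℝ) → ℝ) : Prop :=
  ∀ b : E → ℝ, ∃ β : E → ℝ, (∀ e, 0 ≤ β e) ∧ ∑ e, β e ^ 2 ≤ D ^ 2 ∧
    ∀ a : E → ℝ, F b - F a ≤ ∑ e, β e * |b e - a e|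

section
variable {E : Type*} [Fintype E] {D : ℝ} {F : (E → ℝ) → ℝ}

theorem WeightedLipschitz.apply_sub_le (hF : WeightedLipschitz D F) (hD : 0 ≤ D) (a b : E → ℝ) {ε : ℝ}
    (h : ∀ e, |b e - a e| ≤ ε) : F b - F a ≤ Fintype.card E * D * ε := by
  obtain ⟨β, hβ0, hβ, hba⟩ := hF b
  have hle : ∀ e, β e ≤ D := fun e => by
    refine le_of_sq_le_sq ?_ hD
    exact (Finset.single_le_sum (f := fun e => β e ^ 2) (fun _ _ => sq_nonneg _)
      (Finset.mem_univ e)).trans hβ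
  calc F b - F a ≤ ∑ e, β e * |b e - a e| := hba a
    _ ≤ ∑ _e : E, D * ε := Finset.sum_le_sum fun e _ =>
        mul_le_mul (hle e) (h e) (abs_nonneg _) hD
    _ = _ := by simp [mul_assoc]

theorem WeightedLipschitz.abs_apply_sub_le (hF : WeightedLipschitz D F) (hD : 0 ≤ D) (a b : E → ℝ)
    {ε : ℝ} (h : ∀ e, |b e - a e| ≤ ε) : |F b - F a| ≤ Fintype.card E * D * ε := by
  rw [abs_sub_le_iff]
  exact ⟨hF.apply_sub_le hD a b h, hF.apply_sub_le hD b a fun e => by rw [abs_sub_comm]; exact h e⟩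

theorem WeightedLipschitz.continuous (hF : WeightedLipschitz D F) (hD : 0 ≤ D) :
    Continuous F := by
  have hK : 0 ≤ Fintype.card E * D := by positivity
  refine (LipschitzWith.of_dist_le_mul (K := ⟨Fintype.card E * D, hK⟩) fun b a => ?_).continuous
  rw [Real.dist_eq]
  exact hF.abs_apply_sub_le hD a b fun e => by rw [← Real.dist_eq]; exact dist_le_pi_dist b a e

/-- Since the bound is one-sided, the weights at `b` can be those of whichever function is larger at
`b`. -/
theorem WeightedLipschitz.sup {G : (E → ℝ) → ℝ} (hF : WeightedLipschitz D F)
    (hG : WeightedLipschitz D G) : WeightedLipschitz D fun a => max (F a) (G a) := by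
  intro b
  rcases le_total (F b) (G b) with h | h
  · obtain ⟨β, h0, h1, h2⟩ := hG b
    refine ⟨β, h0, h1, fun a => ?_⟩
    have := h2 a
    change max (F b) (G b) - max (F a) (G a) ≤ _
    rw [max_eq_right h]
    linarith [le_max_right (F a) (G a)]
  · obtain ⟨β, h0, h1, h2⟩ := hF b
    refine ⟨β, h0, h1, fun a => ?_⟩
    have := h2 a
    change max (F b) (G b) - max (F a) (G a) ≤ _
    rw [max_eq_left h]
    linarith [le_max_left (F a) (G a)]

end

/-! ### Concentration for independent variables in [-1, 1] -/

section
variable {Ω : Type*} [MeasurableSpace Ω] {μ : Measure Ω} [IsProbabilityMeasure μ]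

theorem measureReal_mem_eq_prodMass {α : Type*} [MeasurableSpace α]
    [MeasurableSingletonClass α] {m : ℕ} {Y : Fin m → Ω → α} (hY : ∀ i, Measurable (Y i))
    (hind : iIndepFun Y μ) (S : Finset (Fin m → α)) :
    μ.real {ω | (fun i => Y i ω) ∈ S} = prodMass (fun i x => μ.real (Y i ⁻¹' {x})) S := by
  have hset : {ω | (fun i => Y i ω) ∈ S} = ⋃ x ∈ S, ⋂ i ∈ Finset.univ, Y i ⁻¹' {x i} := by
    ext ω
    simp only [Set.mem_ofPred_eq, Set.mem_iUnion, Set.mem_iInter, Set.mem_preimage,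
      Set.mem_singleton_iff, Finset.mem_univ, true_imp_iff, exists_prop]
    exact ⟨fun h => ⟨_, h, fun _ => rfl⟩, fun ⟨x, hx, h⟩ => by
      rwa [show (fun i => Y i ω) = x from funext h]⟩
  rw [hset, measureReal_biUnion_finset]
  · refine Finset.sum_congr rfl fun x _ => ?_
    rw [measureReal_def, hind.measure_inter_preimage_eq_mul Finset.univ
      fun i _ => measurableSet_singleton _, ENNReal.toReal_prod]
    rfl
  · intro x _ y _ hxy
    rw [Function.onFun, Set.disjoint_left]
    intro ω h1 h2
    simp only [Set.mem_iInter, Set.mem_preimage, Set.mem_singleton_iff, Finset.mem_univ,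
      true_imp_iff] at h1 h2
    exact hxy (funext fun i => (h1 i).symm.trans (h2 i))
  · intro x _
    exact Finset.measurableSet_biInter _ fun i _ => hY i (measurableSet_singleton _)

theorem measureReal_le_mul_measureReal_ge_of_finite {α : Type*} [Fintype α] [MeasurableSpace α]
    [MeasurableSingletonClass α] {E : Type*} [Fintype E] {Y : E → Ω → α}
    (hY : ∀ e, Measurable (Y e)) (hind : iIndepFun Y μ) {v : α → ℝ} (hv : ∀ x, |v x| ≤ 1)
    {D : ℝ} (hD : 0 < D) {F : (E → ℝ) → ℝ} (hF : WeightedLipschitz D F) (s u : ℝ)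
    (hsu : s ≤ u) :
    μ.real {ω | F (fun e => v (Y e ω)) ≤ s} * μ.real {ω | u ≤ F (fun e => v (Y e ω))} ≤
      Real.exp (-((u - s) ^ 2 / (16 * D ^ 2))) := by
  classical
  set σ := Fintype.equivFin E
  set S : Finset (Fin (Fintype.card E) → α) :=
    Finset.univ.filter fun x => F (fun e => v (x (σ e))) ≤ s with hS
  set T : Finset (Fin (Fintype.card E) → α) :=
    Finset.univ.filter fun x => u ≤ F (fun e => v (x (σ e))) with hT
  have hY' : ∀ i, Measurable (Y (σ.symm i)) := fun i => hY _
  have hind' : iIndepFun (fun i => Y (σ.symm i)) μ := hind.precomp σ.symm.injective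
  have e1 : {ω | F (fun e => v (Y e ω)) ≤ s} = {ω | (fun i => Y (σ.symm i) ω) ∈ S} := by
    ext ω; simp [hS]
  have e2 : {ω | u ≤ F (fun e => v (Y e ω))} = {ω | (fun i => Y (σ.symm i) ω) ∈ T} := by
    ext ω; simp [hT]
  rw [e1, e2, measureReal_mem_eq_prodMass hY' hind', measureReal_mem_eq_prodMass hY' hind']
  have hmain := prodMass_mul_prodMass_le (fun i x => μ.real (Y (σ.symm i) ⁻¹' {x}))
    (fun _ _ => measureReal_nonneg) (fun i => ?_) S T (sub_nonneg.2 hsu)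
    (mul_pos two_pos hD) ?_
  · convert hmain using 4
    ring
  · rw [← measureReal_biUnion_finset]
    · have : (⋃ b ∈ (Finset.univ : Finset α), Y (σ.symm i) ⁻¹' {b}) = Set.univ := by
        ext ω; simp
      rw [this, probReal_univ]
    · intro x _ y _ hxy
      rw [Function.onFun, Set.disjoint_left]
      intro ω h1 h2
      exact hxy (h1.symm.trans h2)
    · intro x _
      exact hY' i (measurableSet_singleton _)
  · intro x hx
    obtain ⟨β, hβ0, hβ, hβF⟩ := hF fun e => v (x (σ e))
    -- Two values in [-1, 1] differ by at most 2, so the weights double and 4D² becomes 16D².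
    refine ⟨fun i => 2 * β (σ.symm i), fun i => by have := hβ0 (σ.symm i); positivity, ?_, ?_⟩
    · rw [σ.symm.sum_comp (fun e => (2 * β e) ^ 2)]
      simp only [mul_pow, ← Finset.mul_sum]
      linarith
    · intro a ha
      have hx' := (Finset.mem_filter.1 hx).2
      have ha' := (Finset.mem_filter.1 ha).2
      have h1 := hβF fun e => v (a (σ e))
      rw [← σ.sum_comp]
      refine (by linarith : u - s ≤ _).trans (h1.trans (Finset.sum_le_sum fun e _ => ?_))
      simp only [σ.symm_apply_apply]
      split_ifs with hne
      · have h2 : |v (x (σ e)) - v (a (σ e))| ≤ 2 :=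
          (abs_sub _ _).trans (by linarith [hv (x (σ e)), hv (a (σ e))])
        nlinarith [hβ0 e]
      · simp [not_not.1 hne]

/-- The index of the cell of length `1 / N` of `[-1, 1]` that contains `x`. -/
noncomputable def gridIndex (N : ℕ) (x : ℝ) : Fin (2 * N + 1) :=
  ⟨min ⌊N * (x + 1)⌋₊ (2 * N), by omega⟩

/-- The left endpoint of a cell of length `1 / N` of `[-1, 1]`. -/
noncomputable def gridPoint (N : ℕ) (k : Fin (2 * N + 1)) : ℝ := (k : ℕ) / N - 1

theorem measurable_gridIndex (N : ℕ) : Measurable (gridIndex N) := by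
  have h1 : Measurable fun x : ℝ => ⌊(N : ℝ) * (x + 1)⌋₊ :=
    Nat.measurable_floor.comp (by fun_prop)
  exact (measurable_from_top (f := fun k : ℕ =>
    (⟨min k (2 * N), by omega⟩ : Fin (2 * N + 1)))).comp h1

theorem abs_gridPoint_le {N : ℕ} (hN : 0 < N) (k : Fin (2 * N + 1)) : |gridPoint N k| ≤ 1 := by
  have hN' : (0 : ℝ) < N := by exact_mod_cast hN
  have hk : ((k : ℕ) : ℝ) ≤ 2 * N := by exact_mod_cast Nat.lt_succ_iff.1 k.2
  have h1 : ((k : ℕ) : ℝ) / N ≤ 2 := by rw [div_le_iff₀ hN']; exact hk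
  have h2 : 0 ≤ ((k : ℕ) : ℝ) / N := by positivity
  rw [gridPoint, abs_le]
  constructor <;> linarith

theorem abs_gridPoint_gridIndex_sub_le {N : ℕ} (hN : 0 < N) {x : ℝ} (hx : |x| ≤ 1) :
    |gridPoint N (gridIndex N x) - x| ≤ 1 / N := by
  have hN' : (0 : ℝ) < N := by exact_mod_cast hN
  rw [abs_le] at hx
  have h0 : 0 ≤ (N : ℝ) * (x + 1) := mul_nonneg hN'.le (by linarith)
  -- On [-1, 1] the truncation at 2N is inactive; the index 2N is reached only at x = 1.
  have hmin : min ⌊(N : ℝ) * (x + 1)⌋₊ (2 * N) = ⌊(N : ℝ) * (x + 1)⌋₊ := by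
    refine min_eq_left (Nat.floor_le_of_le ?_)
    push_cast
    nlinarith
  have h1 := Nat.floor_le h0
  have h2 := Nat.lt_floor_add_one ((N : ℝ) * (x + 1))
  have e : gridPoint N (gridIndex N x) = (⌊(N : ℝ) * (x + 1)⌋₊ : ℝ) / N - 1 := by
    simp only [gridPoint, gridIndex, hmin]
  have h3 : (⌊(N : ℝ) * (x + 1)⌋₊ : ℝ) / N ≤ x + 1 := by
    rw [div_le_iff₀ hN']; linarith
  have h4 : x + 1 ≤ (⌊(N : ℝ) * (x + 1)⌋₊ : ℝ) / N + 1 / N := by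
    rw [← add_div, le_div_iff₀ hN']; linarith
  rw [e, abs_le]
  constructor <;> linarith

variable {E : Type*} [Fintype E] {X : E → Ω → ℝ} {D : ℝ} {F : (E → ℝ) → ℝ}

/-- Rounding to a grid of mesh 1/N moves F by at most L/N. The finite case applies with both
thresholds shifted by L/N, and N tends to infinity. -/
theorem measureReal_le_mul_measureReal_ge (hX : ∀ e, Measurable (X e)) (hind : iIndepFun X μ)
    (hb : ∀ e, ∀ᵐ ω ∂μ, |X e ω| ≤ 1) (hD : 0 < D) (hF : WeightedLipschitz D F) (s : ℝ) {t : ℝ}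
    (ht : 0 ≤ t) :
    μ.real {ω | F (fun e => X e ω) ≤ s} * μ.real {ω | s + t ≤ F (fun e => X e ω)} ≤
      Real.exp (-(t ^ 2 / (16 * D ^ 2))) := by
  rcases ht.eq_or_lt with rfl | ht
  · simpa using mul_le_one₀ (measureReal_le_one (μ := μ)) measureReal_nonneg measureReal_le_one
  set L : ℝ := Fintype.card E * D
  have hlim : Filter.Tendsto (fun N : ℕ => L * (1 / (N : ℝ))) Filter.atTop (nhds 0) := by
    simpa using tendsto_one_div_atTop_nhds_zero_nat.const_mul L
  have hlim2 : Filter.Tendsto (fun N : ℕ =>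
      Real.exp (-((s + t - L * (1 / (N : ℝ)) - (s + L * (1 / (N : ℝ)))) ^ 2 / (16 * D ^ 2))))
      Filter.atTop (nhds (Real.exp (-(t ^ 2 / (16 * D ^ 2))))) := by
    have h := (((hlim.const_sub (s + t)).sub (hlim.const_add s)).pow 2).div_const (16 * D ^ 2)
    rw [show s + t - 0 - (s + 0) = t by ring] at h
    exact (Real.continuous_exp.tendsto _).comp h.neg
  refine ge_of_tendsto hlim2 ?_
  -- L/N < t/2 keeps the shifted thresholds in order.
  filter_upwards [hlim.eventually (gt_mem_nhds (half_pos ht)), Filter.eventually_gt_atTop 0]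
    with N hN1 hN0
  have hall : ∀ᵐ ω ∂μ, ∀ e, |X e ω| ≤ 1 := ae_all_iff.2 hb
  have hclose : ∀ᵐ ω ∂μ, |F (fun e => gridPoint N (gridIndex N (X e ω))) - F fun e => X e ω| ≤
      L * (1 / (N : ℝ)) := by
    filter_upwards [hall] with ω hω
    exact hF.abs_apply_sub_le hD.le _ _ fun e => abs_gridPoint_gridIndex_sub_le hN0 (hω e)
  have hfin := measureReal_le_mul_measureReal_ge_of_finite (μ := μ)
    (Y := fun e ω => gridIndex N (X e ω)) (fun e => (measurable_gridIndex N).comp (hX e))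
    (hind.comp (fun _ => gridIndex N) fun _ => measurable_gridIndex N) (v := gridPoint N)
    (abs_gridPoint_le hN0) hD hF (s + L * (1 / (N : ℝ))) (s + t - L * (1 / (N : ℝ)))
    (by linarith)
  refine (mul_le_mul ?_ ?_ measureReal_nonneg measureReal_nonneg).trans hfin
  · refine ENNReal.toReal_mono (measure_ne_top _ _) (measure_mono_ae ?_)
    filter_upwards [hclose] with ω hω h
    rw [abs_le] at hω
    change _ ≤ _ at h
    change _ ≤ _
    linarith
  · refine ENNReal.toReal_mono (measure_ne_top _ _) (measure_mono_ae ?_)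
    filter_upwards [hclose] with ω hω h
    rw [abs_le] at hω
    change _ ≤ _ at h
    change _ ≤ _
    linarith

/-- The least point where the distribution function reaches 1/2 works: right continuity gives the
first bound, the left limit the second. -/
theorem exists_median {G : Ω → ℝ} (hG : Measurable G) :
    ∃ m : ℝ, 1 / 2 ≤ μ.real {ω | G ω ≤ m} ∧ 1 / 2 ≤ μ.real {ω | m ≤ G ω} := by
  have := Measure.isProbabilityMeasure_map (μ := μ) hG.aemeasurable
  set ν := μ.map G
  have hcdf : ∀ x, cdf ν x = μ.real {ω | G ω ≤ x} := fun x => by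
    rw [cdf_eq_real, map_measureReal_apply hG measurableSet_Iic]; rfl
  set S : Set ℝ := {x | 1 / 2 ≤ cdf ν x} with hS
  have hne : S.Nonempty :=
    ((tendsto_cdf_atTop ν).eventually (le_mem_nhds (by norm_num : (1 / 2 : ℝ) < 1))).exists
  have hbdd : BddBelow S := by
    obtain ⟨y, hy⟩ := ((tendsto_cdf_atBot ν).eventually
      (gt_mem_nhds (by norm_num : (0 : ℝ) < 1 / 2))).exists
    refine ⟨y, fun x hx => ?_⟩
    by_contra hlt
    have := monotone_cdf ν (not_le.1 hlt).le
    have hx' : 1 / 2 ≤ cdf ν x := hx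
    linarith
  refine ⟨sInf S, ?_, ?_⟩
  · rw [← hcdf]
    have hr := ((cdf ν).right_continuous (sInf S)).mono Set.Ioi_subset_Ici_self
    refine ge_of_tendsto hr ?_
    filter_upwards [self_mem_nhdsWithin] with x hx
    obtain ⟨y, hy, hyx⟩ := exists_lt_of_csInf_lt hne hx
    exact le_trans hy (monotone_cdf ν hyx.le)
  · have hlt : μ.real {ω | G ω < sInf S} ≤ 1 / 2 := by
      have e1 : μ.real {ω | G ω < sInf S} = (cdf ν).measure.real (Set.Iio (sInf S)) := by
        rw [measure_cdf, map_measureReal_apply hG measurableSet_Iio]; rfl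
      rw [e1, measureReal_def, StieltjesFunction.measure_Iio _ (tendsto_cdf_atBot ν), sub_zero]
      refine ENNReal.toReal_le_of_le_ofReal (by norm_num) (ENNReal.ofReal_le_ofReal ?_)
      refine le_of_tendsto ((monotone_cdf ν).tendsto_leftLim _) ?_
      filter_upwards [self_mem_nhdsWithin] with x hx
      by_contra hx'
      exact absurd (csInf_le hbdd (not_le.1 hx').le) (not_le.2 hx)
    have hcompl : {ω | sInf S ≤ G ω} = {ω | G ω < sInf S}ᶜ := by ext; simp
    rw [hcompl, probReal_compl_eq_one_sub (measurableSet_lt hG measurable_const)]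
    linarith

/-- The two-set bound is applied to the thresholds m, m + t and m - t, m. The side bounded by the
median has mass at least 1/2, so each tail costs a factor 2. -/
theorem exists_measureReal_abs_sub_ge_le (hX : ∀ e, Measurable (X e)) (hind : iIndepFun X μ)
    (hb : ∀ e, ∀ᵐ ω ∂μ, |X e ω| ≤ 1) (hD : 0 < D) (hF : WeightedLipschitz D F) :
    ∃ m : ℝ, ∀ t : ℝ, 0 ≤ t → μ.real {ω | t ≤ |F (fun e => X e ω) - m|} ≤
      4 * Real.exp (-(1 / (16 * D ^ 2)) * t ^ 2) := by
  have hG : Measurable fun ω => F fun e => X e ω :=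
    (hF.continuous hD.le).measurable.comp (measurable_pi_lambda _ hX)
  obtain ⟨m, hm1, hm2⟩ := exists_median (μ := μ) hG
  refine ⟨m, fun t ht => ?_⟩
  have h1 := measureReal_le_mul_measureReal_ge hX hind hb hD hF m ht
  have h2 := measureReal_le_mul_measureReal_ge hX hind hb hD hF (m - t) ht
  rw [sub_add_cancel] at h2
  have e : -(1 / (16 * D ^ 2)) * t ^ 2 = -(t ^ 2 / (16 * D ^ 2)) := by ring
  rw [e]
  have hsub : {ω | t ≤ |F (fun e => X e ω) - m|} ⊆
      {ω | m + t ≤ F fun e => X e ω} ∪ {ω | F (fun e => X e ω) ≤ m - t} := by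
    intro ω hω
    have hω' : t ≤ |F (fun e => X e ω) - m| := hω
    rcases le_abs.1 hω' with h | h
    · exact Or.inl (by rw [Set.mem_ofPred_eq]; linarith)
    · exact Or.inr (by rw [Set.mem_ofPred_eq]; linarith)
  have h3 := (measureReal_mono (μ := μ) hsub).trans (measureReal_union_le _ _)
  have h4 := mul_le_mul_of_nonneg_right hm1
    (measureReal_nonneg (μ := μ) (s := {ω | m + t ≤ F fun e => X e ω}))
  have h5 := mul_le_mul_of_nonneg_left hm2
    (measureReal_nonneg (μ := μ) (s := {ω | F (fun e => X e ω) ≤ m - t}))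
  linarith

theorem WeightedLipschitz.integrable (hX : ∀ e, Measurable (X e))
    (hb : ∀ e, ∀ᵐ ω ∂μ, |X e ω| ≤ 1) (hD : 0 ≤ D) (hF : WeightedLipschitz D F) :
    Integrable (fun ω => F fun e => X e ω) μ := by
  have hG : Measurable fun ω => F fun e => X e ω :=
    (hF.continuous hD).measurable.comp (measurable_pi_lambda _ hX)
  refine Integrable.of_bound hG.aestronglyMeasurable (|F 0| + Fintype.card E * D * 1) ?_
  filter_upwards [ae_all_iff.2 hb] with ω hω
  have h := hF.abs_apply_sub_le hD 0 (fun e => X e ω) (ε := 1) fun e => by simpa using hω e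
  rw [Real.norm_eq_abs]
  calc |F fun e => X e ω| = |F 0 + (F (fun e => X e ω) - F 0)| := by congr 1; ring
    _ ≤ _ := (abs_add_le _ _).trans (by linarith)

/-- Concentration around the mean of a function of independent random variables in `[-1, 1]`. -/
theorem WeightedLipschitz.measureReal_abs_sub_integral_ge_le (hX : ∀ e, Measurable (X e))
    (hind : iIndepFun X μ) (hb : ∀ e, ∀ᵐ ω ∂μ, |X e ω| ≤ 1) (hD : 0 < D)
    (hF : WeightedLipschitz D F) {t : ℝ} (ht : 32 * D ≤ t) :
    μ.real {ω | t ≤ |F (fun e => X e ω) - ∫ ω', F (fun e => X e ω') ∂μ|} ≤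
      Real.exp (-(1 / (128 * D ^ 2)) * t ^ 2) := by
  set G : Ω → ℝ := fun ω => F fun e => X e ω with hGdef
  have hint : Integrable G μ := hF.integrable hX hb hD.le
  obtain ⟨m, hm⟩ := exists_measureReal_abs_sub_ge_le hX hind hb hD hF
  change ∀ t : ℝ, 0 ≤ t → μ.real {ω | t ≤ |G ω - m|} ≤ _ at hm
  have hc : 0 < 1 / (16 * D ^ 2) := by positivity
  -- Integrating the tail gives 8√π D, at most 16D because π ≤ 4. For t ≥ 32D this shift is at most
  -- t/2.
  have hmean : |∫ ω, G ω ∂μ - m| ≤ 16 * D := by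
    have e1 : ∫ ω, G ω ∂μ - m = ∫ ω, (G ω - m) ∂μ := by
      rw [integral_sub hint (integrable_const m)]; simp
    have hint' : Integrable (fun ω => |G ω - m|) μ := (hint.sub (integrable_const m)).abs
    rw [e1]
    calc |∫ ω, (G ω - m) ∂μ| ≤ ∫ ω, |G ω - m| ∂μ := abs_integral_le_integral_abs
      _ = ∫ t in Set.Ioi 0, μ.real {ω | t ≤ |G ω - m|} :=
          hint'.integral_eq_integral_meas_le (Filter.Eventually.of_forall fun _ => abs_nonneg _)
      _ ≤ ∫ t in Set.Ioi 0, 4 * Real.exp (-(1 / (16 * D ^ 2)) * t ^ 2) := by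
          refine integral_mono_of_nonneg
            (Filter.Eventually.of_forall fun _ => measureReal_nonneg)
            ((integrable_exp_neg_mul_sq hc).const_mul 4).integrableOn ?_
          filter_upwards [ae_restrict_mem measurableSet_Ioi] with t ht
          exact hm t (le_of_lt ht)
      _ = 4 * (√(Real.pi / (1 / (16 * D ^ 2))) / 2) := by
          rw [integral_const_mul, integral_gaussian_Ioi]
      _ ≤ 16 * D := by
          have : √(Real.pi / (1 / (16 * D ^ 2))) ≤ 8 * D := by
            rw [Real.sqrt_le_left (by positivity)]
            have h1 : Real.pi / (1 / (16 * D ^ 2)) = Real.pi * (16 * D ^ 2) := by field_simp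
            rw [h1]
            nlinarith [Real.pi_le_four, mul_le_mul_of_nonneg_right Real.pi_le_four
              (by positivity : 0 ≤ 16 * D ^ 2)]
          linarith
  have hsub : {ω | t ≤ |G ω - ∫ ω', G ω' ∂μ|} ⊆ {ω | t / 2 ≤ |G ω - m|} := by
    intro ω hω
    have h1 : t ≤ |G ω - ∫ ω', G ω' ∂μ| := hω
    have h2 := abs_sub_le (G ω) m (∫ ω', G ω' ∂μ)
    rw [abs_sub_comm m] at h2
    rw [Set.mem_ofPred_eq]
    linarith
  have ht0 : 0 < t := by linarith
  refine (measureReal_mono hsub).trans ((hm _ (by positivity)).trans ?_)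
  -- At t/2 the exponent is t²/(64D²). Half of it is kept, and the other half, at least 8, absorbs
  -- the factor 4.
  have hx : 8 ≤ 1 / (128 * D ^ 2) * t ^ 2 := by
    rw [div_mul_eq_mul_div, le_div_iff₀ (by positivity)]
    nlinarith [mul_le_mul ht ht (by positivity) ht0.le]
  have e2 : Real.exp (-(1 / (128 * D ^ 2)) * t ^ 2) =
      Real.exp (1 / (128 * D ^ 2) * t ^ 2) * Real.exp (-(1 / (16 * D ^ 2)) * (t / 2) ^ 2) := by
    rw [← Real.exp_add]
    congr 1
    field_simp
    ring
  rw [e2]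
  refine mul_le_mul_of_nonneg_right ?_ (Real.exp_pos _).le
  linarith [Real.add_one_le_exp (1 / (128 * D ^ 2) * t ^ 2)]

end

/-! ### Variational bounds for the eigenvalues -/

section
variable {n : ℕ} {A : Matrix (Fin n) (Fin n) ℝ}

theorem delta_antitone (hA : A.IsHermitian) : Antitone (delta hA) := fun i j hij =>
  hA.eigenvalues₀_antitone (show Fin.cast _ i ≤ Fin.cast _ j from hij)

theorem exists_orthonormalBasis_mulVec_eq_delta (hA : A.IsHermitian) :
    ∃ b : OrthonormalBasis (Fin n) ℝ (EuclideanSpace ℝ (Fin n)),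
      ∀ k, A.mulVec (b k).ofLp = delta hA k • (b k).ofLp := by
  -- `eigenvectorBasis` is indexed through an equivalence of index types; undoing it attaches the
  -- k-th vector to the k-th largest eigenvalue.
  set σ : Fin n ≃ Fin n := (finCongr (Fintype.card_fin n).symm).trans
    (Fintype.equivOfCardEq (Fintype.card_fin _)) with hσ
  refine ⟨hA.eigenvectorBasis.reindex σ.symm, fun k => ?_⟩
  rw [OrthonormalBasis.reindex_apply, Equiv.symm_symm, hA.mulVec_eigenvectorBasis]
  congr 1
  simp [Matrix.IsHermitian.eigenvalues, delta, hσ]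

theorem dotProduct_mulVec_eq_sum_delta (hA : A.IsHermitian)
    {b : OrthonormalBasis (Fin n) ℝ (EuclideanSpace ℝ (Fin n))}
    (hb : ∀ k, A.mulVec (b k).ofLp = delta hA k • (b k).ofLp) (x : EuclideanSpace ℝ (Fin n)) :
    x.ofLp ⬝ᵥ A.mulVec x.ofLp = ∑ k, delta hA k * inner ℝ (b k) x ^ 2 := by
  have h1 : ∀ k, inner ℝ (b k) (WithLp.toLp 2 (A.mulVec x.ofLp)) =
      delta hA k * inner ℝ (b k) x := by
    intro k
    have hT : A.IsSymm := by simpa using hA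
    simp only [EuclideanSpace.inner_eq_star_dotProduct, star_trivial]
    rw [dotProduct_comm, Matrix.dotProduct_mulVec, ← Matrix.mulVec_transpose, hT.eq, hb k,
      smul_dotProduct, smul_eq_mul, dotProduct_comm]
  have h2 := b.sum_inner_mul_inner x (WithLp.toLp 2 (A.mulVec x.ofLp))
  have h3 : inner ℝ x (WithLp.toLp 2 (A.mulVec x.ofLp)) = x.ofLp ⬝ᵥ A.mulVec x.ofLp := by
    simp [EuclideanSpace.inner_eq_star_dotProduct, dotProduct_comm]
  rw [← h3, ← h2]
  refine Finset.sum_congr rfl fun k _ => ?_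
  rw [h1, real_inner_comm]
  ring

/-- Parseval spreads a constant over the eigenbasis, so that it can be compared with a quadratic
form term by term. -/
theorem sum_mul_inner_sq_eq (b : OrthonormalBasis (Fin n) ℝ (EuclideanSpace ℝ (Fin n)))
    {x : EuclideanSpace ℝ (Fin n)} (hx : ‖x‖ = 1) (d : ℝ) :
    ∑ k, d * inner ℝ (b k) x ^ 2 = d := by
  have h := b.sum_sq_norm_inner_right x
  simp only [Real.norm_eq_abs, sq_abs, hx] at h
  rw [← Finset.mul_sum, h]
  ring

theorem sum_ofLp_sq (x : EuclideanSpace ℝ (Fin n)) : ∑ i, x.ofLp i ^ 2 = ‖x‖ ^ 2 := by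
  simp [EuclideanSpace.norm_sq_eq]

theorem exists_sq_add_sq_eq_one_orthogonal (p q : ℝ) :
    ∃ c d : ℝ, c ^ 2 + d ^ 2 = 1 ∧ c * p + d * q = 0 := by
  by_cases h : p ^ 2 + q ^ 2 = 0
  · have hp : p = 0 := by nlinarith [sq_nonneg p, sq_nonneg q]
    have hq : q = 0 := by nlinarith [sq_nonneg p, sq_nonneg q]
    exact ⟨1, 0, by norm_num, by simp [hp]⟩
  · have hpos : 0 < p ^ 2 + q ^ 2 := lt_of_le_of_ne (by positivity) (Ne.symm h)
    have hs := Real.sq_sqrt hpos.le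
    have hs0 : √(p ^ 2 + q ^ 2) ≠ 0 := (Real.sqrt_pos.2 hpos).ne'
    refine ⟨q / √(p ^ 2 + q ^ 2), -p / √(p ^ 2 + q ^ 2), ?_, ?_⟩
    · rw [div_pow, div_pow, hs, ← add_div, div_eq_one_iff_eq h]
      ring
    · field_simp
      ring

/-- The plane of the two leading eigenvectors contains, for every `A`, a unit vector at which the
quadratic form of `A` is at most `δ₂(A)`. -/
theorem exists_envelope_delta2 (hn : 2 ≤ n) {B : Matrix (Fin n) (Fin n) ℝ} (hB : B.IsHermitian) :
    ∃ r : Fin n → ℝ, (∀ i, 0 ≤ r i) ∧ ∑ i, r i ^ 2 ≤ 2 ∧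
      ∀ {A : Matrix (Fin n) (Fin n) ℝ} (hA : A.IsHermitian), ∃ w : Fin n → ℝ,
        (∀ i, |w i| ≤ r i) ∧ w ⬝ᵥ A.mulVec w ≤ delta2 hn hA ∧ delta2 hn hB ≤ w ⬝ᵥ B.mulVec w := by
  obtain ⟨b, hb⟩ := exists_orthonormalBasis_mulVec_eq_delta hB
  set i0 : Fin n := ⟨0, by omega⟩ with hi0
  set i1 : Fin n := ⟨1, by omega⟩ with hi1
  have hne : i0 ≠ i1 := by simp [hi0, hi1]
  refine ⟨fun i => √((b i0).ofLp i ^ 2 + (b i1).ofLp i ^ 2), fun i => Real.sqrt_nonneg _, ?_, ?_⟩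
  · have h : ∀ i, √((b i0).ofLp i ^ 2 + (b i1).ofLp i ^ 2) ^ 2 =
        (b i0).ofLp i ^ 2 + (b i1).ofLp i ^ 2 := fun i => Real.sq_sqrt (by positivity)
    simp only [h, Finset.sum_add_distrib, sum_ofLp_sq, b.norm_eq_one]
    norm_num
  · intro A hA
    obtain ⟨v, hv⟩ := exists_orthonormalBasis_mulVec_eq_delta hA
    -- A plane always meets the hyperplane orthogonal to the leading eigenvector of `A`.
    obtain ⟨c, d, hcd, horth⟩ := exists_sq_add_sq_eq_one_orthogonal
      (inner ℝ (v i0) (b i0)) (inner ℝ (v i0) (b i1))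
    set w : EuclideanSpace ℝ (Fin n) := c • b i0 + d • b i1 with hw
    have hbw : ∀ k, inner ℝ (b k) w = (if k = i0 then c else 0) + if k = i1 then d else 0 := by
      intro k
      rw [hw, inner_add_right, inner_smul_right, inner_smul_right, b.inner_eq_ite, b.inner_eq_ite]
      simp
    have hnorm : ‖w‖ = 1 := by
      have h1 : ‖w‖ ^ 2 = 1 := by
        rw [← real_inner_self_eq_norm_sq, hw, inner_add_left, inner_smul_left, inner_smul_left,
          ← hw, hbw, hbw]
        simp [hne, hne.symm]
        linarith
      nlinarith [norm_nonneg w]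
    refine ⟨w.ofLp, fun i => ?_, ?_, ?_⟩
    · apply Real.abs_le_sqrt
      have h1 : w.ofLp i = c * (b i0).ofLp i + d * (b i1).ofLp i := by simp [hw]
      rw [h1]
      -- Lagrange's identity: (cp + dq)² + (cq - dp)² = (c² + d²)(p² + q²).
      nlinarith [sq_nonneg (c * (b i1).ofLp i - d * (b i0).ofLp i)]
    · rw [dotProduct_mulVec_eq_sum_delta hA hv, ← sum_mul_inner_sq_eq v hnorm (delta2 hn hA)]
      refine Finset.sum_le_sum fun k _ => ?_
      by_cases hk : k = i0
      · have h0 : inner ℝ (v k) w = 0 := by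
          rw [hk, hw, inner_add_right, inner_smul_right, inner_smul_right]
          exact horth
        simp [h0]
      · refine mul_le_mul_of_nonneg_right (delta_antitone hA ?_) (sq_nonneg _)
        simp only [hi0, Fin.ext_iff, Fin.le_def] at hk ⊢
        omega
    · rw [dotProduct_mulVec_eq_sum_delta hB hb, ← sum_mul_inner_sq_eq b hnorm (delta2 hn hB)]
      refine Finset.sum_le_sum fun k _ => ?_
      by_cases hk : k ≤ i1
      · exact mul_le_mul_of_nonneg_right (delta_antitone hB hk) (sq_nonneg _)
      · have h0 : inner ℝ (b k) w = 0 := by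
          rw [hbw, if_neg, if_neg, add_zero]
          · rintro rfl; exact hk le_rfl
          · rintro rfl; exact hk (by simp [hi0, hi1, Fin.le_def])
        simp [h0]

/-- The last eigenvector of `B` serves for every `A`, since the form of `A` at a unit vector is at
least δₙ(A). Its squares sum to 1; the bound 2 lets δ₂ and δₙ share one weight estimate. -/
theorem exists_envelope_neg_deltaLast (hn : 2 ≤ n) {B : Matrix (Fin n) (Fin n) ℝ}
    (hB : B.IsHermitian) :
    ∃ r : Fin n → ℝ, (∀ i, 0 ≤ r i) ∧ ∑ i, r i ^ 2 ≤ 2 ∧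
      ∀ {A : Matrix (Fin n) (Fin n) ℝ} (hA : A.IsHermitian), ∃ w : Fin n → ℝ,
        (∀ i, |w i| ≤ r i) ∧ deltaLast hn hA ≤ w ⬝ᵥ A.mulVec w ∧
          w ⬝ᵥ B.mulVec w ≤ deltaLast hn hB := by
  obtain ⟨b, hb⟩ := exists_orthonormalBasis_mulVec_eq_delta hB
  set i1 : Fin n := ⟨n - 1, by omega⟩ with hi1
  refine ⟨fun i => |(b i1).ofLp i|, fun i => abs_nonneg _, ?_, fun {A} hA =>
    ⟨(b i1).ofLp, fun i => le_rfl, ?_, ?_⟩⟩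
  · simp only [sq_abs, sum_ofLp_sq, b.norm_eq_one]
    norm_num
  · obtain ⟨v, hv⟩ := exists_orthonormalBasis_mulVec_eq_delta hA
    rw [dotProduct_mulVec_eq_sum_delta hA hv,
      ← sum_mul_inner_sq_eq v (b.norm_eq_one i1) (deltaLast hn hA)]
    refine Finset.sum_le_sum fun k _ =>
      mul_le_mul_of_nonneg_right (delta_antitone hA ?_) (sq_nonneg _)
    rw [Fin.le_def]
    have := k.2
    simp only
    omega
  · have h1 : (b i1).ofLp ⬝ᵥ (b i1).ofLp = 1 := by
      have := sum_ofLp_sq (b i1)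
      rw [b.norm_eq_one] at this
      simpa [dotProduct, sq] using this
    rw [hb, dotProduct_smul, h1, smul_eq_mul, mul_one]
    rfl

/-! ### Lipschitz weights on the upper triangular entries -/

/-- The array with the given entries on and above the diagonal, and zeros below. -/
def upperArray (x : {e : Fin n × Fin n // e.1 ≤ e.2} → ℝ) (i j : Fin n) : ℝ :=
  if h : i ≤ j then x ⟨(i, j), h⟩ else 0

theorem symMatrix_upperArray (x : {e : Fin n × Fin n // e.1 ≤ e.2} → ℝ) (i j : Fin n) :
    symMatrix (upperArray x) i j = x ⟨(min i j, max i j), min_le_max⟩ := by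
  simp [symMatrix, upperArray]

theorem sum_upper_le_sum {g : Fin n × Fin n → ℝ} (hg : ∀ p, 0 ≤ g p) :
    ∑ e : {e : Fin n × Fin n // e.1 ≤ e.2}, g e.1 ≤ ∑ p, g p := by
  rw [← Finset.sum_subtype (Finset.univ.filter fun p : Fin n × Fin n => p.1 ≤ p.2) (by simp) g]
  exact Finset.sum_le_sum_of_subset_of_nonneg (Finset.subset_univ _) fun p _ _ => hg p

theorem sum_le_two_mul_sum_upper {g : Fin n × Fin n → ℝ} (hg : ∀ p, 0 ≤ g p)
    (hsymm : ∀ p, g p.swap = g p) :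
    ∑ p, g p ≤ 2 * ∑ e : {e : Fin n × Fin n // e.1 ≤ e.2}, g e.1 := by
  rw [← Finset.sum_subtype (Finset.univ.filter fun p : Fin n × Fin n => p.1 ≤ p.2) (by simp) g,
    Finset.sum_filter, two_mul]
  nth_rewrite 3 [← (Equiv.prodComm (Fin n) (Fin n)).sum_comp]
  rw [← Finset.sum_add_distrib]
  refine Finset.sum_le_sum fun p _ => ?_
  rw [Equiv.prodComm_apply, hsymm]
  rcases le_total p.1 p.2 with h | h
  · rw [if_pos h]
    split_ifs <;> linarith [hg p]
  · rw [if_pos (show p.swap.1 ≤ p.swap.2 from h)]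
    split_ifs <;> linarith [hg p]

/-- An off-diagonal entry occurs twice in the quadratic form, hence the factor 2, which is merely
generous on the diagonal. -/
theorem abs_dotProduct_mulVec_sub_le {r w : Fin n → ℝ} (hwr : ∀ i, |w i| ≤ r i)
    (a b : {e : Fin n × Fin n // e.1 ≤ e.2} → ℝ) :
    |w ⬝ᵥ (symMatrix (upperArray b)).mulVec w - w ⬝ᵥ (symMatrix (upperArray a)).mulVec w| ≤
      ∑ e, 2 * (r e.1.1 * r e.1.2) * |b e - a e| := by
  have hr : ∀ i, 0 ≤ r i := fun i => (abs_nonneg _).trans (hwr i)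
  set g : Fin n × Fin n → ℝ := fun p => r p.1 * r p.2 *
    |symMatrix (upperArray b) p.1 p.2 - symMatrix (upperArray a) p.1 p.2| with hg
  have h1 : w ⬝ᵥ (symMatrix (upperArray b)).mulVec w - w ⬝ᵥ (symMatrix (upperArray a)).mulVec w =
      ∑ p : Fin n × Fin n, w p.1 * w p.2 *
        (symMatrix (upperArray b) p.1 p.2 - symMatrix (upperArray a) p.1 p.2) := by
    simp only [dotProduct, Matrix.mulVec, Finset.mul_sum, Fintype.sum_prod_type,
      ← Finset.sum_sub_distrib]
    exact Finset.sum_congr rfl fun i _ => Finset.sum_congr rfl fun j _ => by ring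
  have h2 : ∀ e : {e : Fin n × Fin n // e.1 ≤ e.2},
      g e.1 = r e.1.1 * r e.1.2 * |b e - a e| := by
    rintro ⟨⟨i, j⟩, h⟩
    simp only [hg, symMatrix, upperArray, Matrix.of_apply]
    have h' : i ≤ j := h
    simp [h']
  calc _ ≤ ∑ p, g p := by
        rw [h1]
        refine (Finset.abs_sum_le_sum_abs _ _).trans (Finset.sum_le_sum fun p _ => ?_)
        rw [abs_mul, abs_mul]
        exact mul_le_mul_of_nonneg_right
          (mul_le_mul (hwr _) (hwr _) (abs_nonneg _) (hr _)) (abs_nonneg _)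
    _ ≤ 2 * ∑ e : {e : Fin n × Fin n // e.1 ≤ e.2}, g e.1 := by
        refine sum_le_two_mul_sum_upper
          (fun p => mul_nonneg (mul_nonneg (hr _) (hr _)) (abs_nonneg _)) fun p => ?_
        simp only [hg, Prod.fst_swap, Prod.snd_swap, symMatrix, Matrix.of_apply, min_comm p.2,
          max_comm p.2, mul_comm (r p.2)]
    _ = _ := by
        rw [Finset.mul_sum]
        exact Finset.sum_congr rfl fun e _ => by rw [h2]; ring

/-- Over all ordered pairs the sum factors as 4(∑ r_i²)² ≤ 16, the source of D = 4. -/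
theorem sum_two_mul_envelope_sq_le {r : Fin n → ℝ} (hr2 : ∑ i, r i ^ 2 ≤ 2) :
    ∑ e : {e : Fin n × Fin n // e.1 ≤ e.2}, (2 * (r e.1.1 * r e.1.2)) ^ 2 ≤ 4 ^ 2 := by
  refine (sum_upper_le_sum (g := fun p => (2 * (r p.1 * r p.2)) ^ 2)
    fun p => sq_nonneg _).trans ?_
  have h : ∑ p : Fin n × Fin n, (2 * (r p.1 * r p.2)) ^ 2 =
      4 * ((∑ i, r i ^ 2) * ∑ j, r j ^ 2) := by
    rw [Finset.sum_mul_sum, Finset.mul_sum, Fintype.sum_prod_type]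
    refine Finset.sum_congr rfl fun i _ => ?_
    rw [Finset.mul_sum]
    exact Finset.sum_congr rfl fun j _ => by ring
  rw [h]
  have h0 : 0 ≤ ∑ i, r i ^ 2 := Finset.sum_nonneg fun i _ => sq_nonneg _
  nlinarith

theorem weightedLipschitz_delta2 (hn : 2 ≤ n) :
    WeightedLipschitz 4 fun x : {e : Fin n × Fin n // e.1 ≤ e.2} → ℝ =>
      delta2 hn (symMatrix_isHermitian (upperArray x)) := by
  intro b
  obtain ⟨r, hr, hr2, h⟩ := exists_envelope_delta2 hn (symMatrix_isHermitian (upperArray b))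
  refine ⟨fun e => 2 * (r e.1.1 * r e.1.2),
    fun e => mul_nonneg zero_le_two (mul_nonneg (hr _) (hr _)),
    sum_two_mul_envelope_sq_le hr2, fun a => ?_⟩
  obtain ⟨w, hwr, hA, hB⟩ := h (symMatrix_isHermitian (upperArray a))
  exact (sub_le_sub hB hA).trans ((le_abs_self _).trans (abs_dotProduct_mulVec_sub_le hwr a b))

theorem weightedLipschitz_neg_deltaLast (hn : 2 ≤ n) :
    WeightedLipschitz 4 fun x : {e : Fin n × Fin n // e.1 ≤ e.2} → ℝ =>
      -deltaLast hn (symMatrix_isHermitian (upperArray x)) := by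
  intro b
  obtain ⟨r, hr, hr2, h⟩ :=
    exists_envelope_neg_deltaLast hn (symMatrix_isHermitian (upperArray b))
  refine ⟨fun e => 2 * (r e.1.1 * r e.1.2),
    fun e => mul_nonneg zero_le_two (mul_nonneg (hr _) (hr _)),
    sum_two_mul_envelope_sq_le hr2, fun a => ?_⟩
  obtain ⟨w, hwr, hA, hB⟩ := h (symMatrix_isHermitian (upperArray a))
  have h1 := (neg_le_abs _).trans (abs_dotProduct_mulVec_sub_le hwr a b)
  linarith

/-- From δₙ ≤ δ₂ follow -δ₂ ≤ -δₙ and δₙ ≤ δ₂, so the absolute values add nothing to the maximum. -/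
theorem lambda2_eq_max (hn : 2 ≤ n) (hA : A.IsHermitian) :
    lambda2 hn hA = max (delta2 hn hA) (-deltaLast hn hA) := by
  have h : deltaLast hn hA ≤ delta2 hn hA := delta_antitone hA (by
    rw [Fin.le_def]
    simp only
    omega)
  refine le_antisymm (max_le (abs_le'.2 ⟨le_max_left _ _, ?_⟩) (abs_le'.2 ⟨?_, le_max_right _ _⟩))
    (max_le_max (le_abs_self _) (neg_le_abs _))
  · exact (neg_le_neg h).trans (le_max_right _ _)
  · exact h.trans (le_max_left _ _)

theorem weightedLipschitz_lambda2 (hn : 2 ≤ n) :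
    WeightedLipschitz 4 fun x : {e : Fin n × Fin n // e.1 ≤ e.2} → ℝ =>
      lambda2 hn (symMatrix_isHermitian (upperArray x)) := by
  simp only [lambda2_eq_max]
  exact (weightedLipschitz_delta2 hn).sup (weightedLipschitz_neg_deltaLast hn)

theorem symMatrix_eq_symMatrix_upperArray (a : Fin n → Fin n → ℝ) :
    symMatrix a = symMatrix (upperArray fun e : {e : Fin n × Fin n // e.1 ≤ e.2} =>
      a e.1.1 e.1.2) := by
  ext i j
  simp [symMatrix, upperArray]

theorem randLambda2_eq {Ω : Type*} (hn : 2 ≤ n) (a : Fin n → Fin n → Ω → ℝ) :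
    randLambda2 hn a = fun ω => lambda2 hn (symMatrix_isHermitian
      (upperArray fun e : {e : Fin n × Fin n // e.1 ≤ e.2} => a e.1.1 e.1.2 ω)) := by
  funext ω
  simp only [randLambda2, symMatrix_eq_symMatrix_upperArray fun i j => a i j ω]

theorem randDelta2_eq {Ω : Type*} (hn : 2 ≤ n) (a : Fin n → Fin n → Ω → ℝ) :
    randDelta2 hn a = fun ω => delta2 hn (symMatrix_isHermitian
      (upperArray fun e : {e : Fin n × Fin n // e.1 ≤ e.2} => a e.1.1 e.1.2 ω)) := by
  funext ω
  simp only [randDelta2, symMatrix_eq_symMatrix_upperArray fun i j => a i j ω]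

end

/-! ### The concentration theorem -/

theorem theorem2 (p : ℝ) (hp : 0 < p) :
    ∃ c K : ℝ, 0 < c ∧ 0 < K ∧
      ∀ (n : ℕ) (hn : 2 ≤ n) (Ω : Type*) [MeasurableSpace Ω] (μ : Measure Ω)
        [IsProbabilityMeasure μ] (a : Fin n → Fin n → Ω → ℝ),
        (∀ i j, i ≤ j → Measurable (a i j)) →
        iIndepFun (fun e : {e : Fin n × Fin n // e.1 ≤ e.2} => a e.1.1 e.1.2) μ →
        (∀ i j, i ≤ j → ∀ᵐ ω ∂μ, |a i j ω| ≤ 1) →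
        (∀ i j, i < j → ∫ ω, a i j ω ∂μ = p) →
        (Integrable (randLambda2 hn a) μ ∧
          ∀ t : ℝ, K < t →
            μ.real {ω | t ≤ |randLambda2 hn a ω - ∫ ω', randLambda2 hn a ω' ∂μ|}
              ≤ Real.exp (-c * t ^ 2)) ∧
        (Integrable (randDelta2 hn a) μ ∧
          ∀ t : ℝ, K < t →
            μ.real {ω | t ≤ |randDelta2 hn a ω - ∫ ω', randDelta2 hn a ω' ∂μ|}
              ≤ Real.exp (-c * t ^ 2)) := by
  -- The constants 1/(128D²) and 32D of the concentration bound at D = 4.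
  refine ⟨1 / (128 * 4 ^ 2), 32 * 4, by norm_num, by norm_num, ?_⟩
  intro n hn Ω _ μ _ a hmeas hind hbound _
  have hX : ∀ e : {e : Fin n × Fin n // e.1 ≤ e.2}, Measurable (a e.1.1 e.1.2) :=
    fun e => hmeas _ _ e.2
  have hb : ∀ e : {e : Fin n × Fin n // e.1 ≤ e.2}, ∀ᵐ ω ∂μ, |a e.1.1 e.1.2 ω| ≤ 1 :=
    fun e => hbound _ _ e.2
  rw [randLambda2_eq, randDelta2_eq]
  exact ⟨⟨(weightedLipschitz_lambda2 hn).integrable hX hb (by norm_num), fun t ht =>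
      (weightedLipschitz_lambda2 hn).measureReal_abs_sub_integral_ge_le hX hind hb
        (by norm_num) ht.le⟩,
    ⟨(weightedLipschitz_delta2 hn).integrable hX hb (by norm_num), fun t ht =>
      (weightedLipschitz_delta2 hn).measureReal_abs_sub_integral_ge_le hX hind hb
        (by norm_num) ht.le⟩⟩
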